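/- Let $\Omega\subset\mathbb R^d$ be a domain, i.e. the closure of a nonempty bounded connected open set, and let $V:\Omega\to\mathbb R$ be of class $C^1$. Let $\mathcal P(\Omega)$ be the set of Borel probability measures on $\Omega$. For $\varrho\in\mathcal P(\Omega)$ put $$J(\varrho)=\mathcal E(\varrho)+\int_\Omega V\,\mathrm d\varrho,\qquad \mathcal E(\varrho)=\begin{cases}\int_\Omega \varrho(x)\log\varrho(x)\,\mathrm dx\in(-\infty,+\infty] & \text{if }\varrho\ll\mathcal L^d,\\ +\infty&\text{otherwise,}\end{cases}$$ where an absolutely continuous $\varrho$ is identified with its density and $0\log 0=0$. For $\mu,\nu\in\mathcal P(\Omega)$ let $W_2(\mu,\nu)=\big(\inf_\gamma\int_{\Omega\times\Omega}|x-y|^2\,\mathrm d\gamma(x,y)\big)^{1/2}$, the infimum being over all probability measures $\gamma$ on $\Omega\times\Omega$ with marginals $\mu$ and $\nu$. Then: 1. $J$ has a unique minimizer over $\mathcal P(\Omega)$, and $J$ is bounded from below: there is $C\in\mathbb R$ with $J(\varrho)\ge C$ for all $\varrho\in\mathcal P(\Omega)$. 2. For every $\tau>0$ and every $\varrho_0\in\mathcal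 P(\Omega)$ with $J(\varrho_0)<+\infty$, the recursive scheme $\varrho^\tau_{(0)}=\varrho_0$, $$\varrho^\tau_{(k+1)}\in\operatorname*{argmin}_{\varrho\in\mathcal P(\Omega)}\ J(\varrho)+\frac{W_2^2(\varrho,\varrho^\tau_{(k)})}{2\tau}\qquad(k\ge 0)$$ is well-posed: at every step there is a minimizer, and this minimizer is unique. -/

import Mathlib

open MeasureTheory
open scoped ENNReal

noncomputable section

/-- A domain of `ℝ^d`: the closure of a bounded and connected (in particular nonempty) open set. -/
def IsClosedDomain {d : ℕ} (Ω : Set (EuclideanSpace ℝ (Fin d))) : Prop :=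
  ∃ U : Set (EuclideanSpace ℝ (Fin d)),
    IsOpen U ∧ IsConnected U ∧ Bornology.IsBounded U ∧ Ω = closure U

/-- The integral `∫ f ∂μ` with values in `[-∞, +∞]`, as the integral of the positive part minus
the integral of the negative part. (It is used only where the latter is finite.) -/
def extendedIntegral {X : Type*} [MeasurableSpace X] (μ : Measure X) (f : X → ℝ) : EReal :=
  ((∫⁻ x, ENNReal.ofReal (f x) ∂μ : ℝ≥0∞) : EReal) -
    ((∫⁻ x, ENNReal.ofReal (-f x) ∂μ : ℝ≥0∞) : EReal)

/-- The Lebesgue measure on a (closed) set `Ω`. -/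
def lebesgueOn {d : ℕ} (Ω : Set (EuclideanSpace ℝ (Fin d))) : Measure Ω :=
  (volume : Measure (EuclideanSpace ℝ (Fin d))).comap Subtype.val

/-- The density of a probability measure `ρ` on `Ω` with respect to the Lebesgue measure. -/
def lebesgueDensity {d : ℕ} {Ω : Set (EuclideanSpace ℝ (Fin d))}
    (ρ : ProbabilityMeasure Ω) (x : Ω) : ℝ :=
  ((ρ : Measure Ω).rnDeriv (lebesgueOn Ω) x).toReal

open Classical in
/-- The entropy: `∫_Ω ρ log ρ dx` if `ρ` is absolutely continuous with respect to the Lebesgue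
measure (and is identified with its density), and `+∞` otherwise. As `t log t ≥ -1/e`, the integral
always makes sense in `(-∞, +∞]` when `Ω` has finite Lebesgue measure. -/
def entropy {d : ℕ} {Ω : Set (EuclideanSpace ℝ (Fin d))} (ρ : ProbabilityMeasure Ω) : EReal :=
  if (ρ : Measure Ω) ≪ lebesgueOn Ω then
    extendedIntegral (lebesgueOn Ω)
      (fun x => lebesgueDensity ρ x * Real.log (lebesgueDensity ρ x))
  else ⊤

/-- The functional `J(ρ) = ∫_Ω ρ log ρ + ∫_Ω V dρ`. -/
def freeEnergy {d : ℕ} {Ω : Set (EuclideanSpace ℝ (Fin d))}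
    (V : EuclideanSpace ℝ (Fin d) → ℝ) (ρ : ProbabilityMeasure Ω) : EReal :=
  entropy ρ + ((∫ x, V (x : EuclideanSpace ℝ (Fin d)) ∂(ρ : Measure Ω) : ℝ) : EReal)

/-- The transport plans between `μ` and `ν`: the probability measures on `X × X` with marginals
`μ` and `ν`. -/
def transportPlans {X : Type*} [MeasurableSpace X] (μ ν : ProbabilityMeasure X) :
    Set (ProbabilityMeasure (X × X)) :=
  {γ | (γ : Measure (X × X)).map Prod.fst = μ ∧ (γ : Measure (X × X)).map Prod.snd = ν}

/-- The Wasserstein distance `W₂`: the square root of the minimal transport cost for the cost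
`|x - y|²`. -/
def wasserstein2 {X : Type*} [MeasurableSpace X] [PseudoEMetricSpace X]
    (μ ν : ProbabilityMeasure X) : ℝ≥0∞ :=
  (⨅ γ ∈ transportPlans μ ν, ∫⁻ z, edist z.1 z.2 ^ 2 ∂(γ : Measure (X × X))) ^ (1 / 2 : ℝ)

/-- The functional `ρ ↦ J(ρ) + W₂²(ρ, σ) / (2τ)` of one step of the minimizing movement scheme. -/
def jkoFunctional {d : ℕ} {Ω : Set (EuclideanSpace ℝ (Fin d))}
    (V : EuclideanSpace ℝ (Fin d) → ℝ) (τ : ℝ) (σ ρ : ProbabilityMeasure Ω) : EReal :=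
  freeEnergy V ρ + ((wasserstein2 ρ σ ^ 2 / ENNReal.ofReal (2 * τ) : ℝ≥0∞) : EReal)

/-- `x` is a minimizer of `F` over the whole space. -/
def IsMinimizer {α : Type*} (F : α → EReal) (x : α) : Prop :=
  ∀ y, F x ≤ F y

end

/-! ### Scalar inequalities for `t log t`. -/

open Filter Topology

/-! Both claims are one statement: entropy plus a nonnegative penalty `G` has a unique minimizer,
with `G` equal to `∫ (V + M) dρ`, where `M` bounds `|V|`, or to this plus `W₂²/(2τ)`. Adding 1 to
the integrand `t log t` makes everything `ℝ≥0∞`-valued; the constants removed are real, which also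
gives the lower bound on `J`.

No weak compactness is used. The entropy is uniformly midpoint convex: the convexity defect controls
the squared Hellinger distance of the densities (`mul_log_midpoint_le`,
`shiftedEntropy_midpoint_le`). As `G` is midpoint convex, almost minimizers are therefore close in
`L¹` (`lintegral_enorm_sub_le_of_almost_minimizers`): minimizing sequences are Cauchy, and two
minimizers coincide. The limit is a minimizer by Fatou for the entropy and by Lipschitz continuity
of `G` in total variation. For the transport cost this continuity comes from modifying a plan only
on the mass where the two measures differ (`exists_transportPlan_le`). -/

theorem mul_log_add_le {a m : ℝ} (ha : 0 ≤ a) (hm : 0 ≤ m) (h : m = 0 → a = 0) :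
    a * Real.log m + 2 * a - 2 * (√a * √m) ≤ a * Real.log a := by
  rcases ha.eq_or_lt with rfl | ha
  · simp
  have hm : 0 < m := hm.lt_of_ne fun h0 => ha.ne' (h h0.symm)
  have h1 : 0 < √a := Real.sqrt_pos.2 ha
  have h2 : 0 < √m := Real.sqrt_pos.2 hm
  -- Taking the tangent inequality at `√m / √a` instead of `m / a` is what leaves square roots,
  -- hence a Hellinger term, in the bound.
  have h3 := Real.log_le_sub_one_of_pos (div_pos h2 h1)
  rw [Real.log_div h2.ne' h1.ne', Real.log_sqrt hm.le, Real.log_sqrt ha.le] at h3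
  have h4 : a * (√m / √a) = √a * √m := by
    field_simp
    rw [Real.sq_sqrt ha.le]
  nlinarith [mul_le_mul_of_nonneg_left h3 ha.le]

/-- A quantitative midpoint convexity of `t ↦ t log t`. -/
theorem mul_log_midpoint_le {a b : ℝ} (ha : 0 ≤ a) (hb : 0 ≤ b) :
    2 * ((a + b) / 2 * Real.log ((a + b) / 2)) + (√a - √b) ^ 2 / 2 ≤
      a * Real.log a + b * Real.log b := by
  have hm : 0 ≤ (a + b) / 2 := by linarith
  have h1 := mul_log_add_le ha hm (fun h => by linarith)
  have h2 := mul_log_add_le hb hm (fun h => by linarith)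
  have := Real.sq_sqrt ha
  have := Real.sq_sqrt hb
  have := Real.sq_sqrt hm
  -- With `m = (a + b) / 2`, the two error terms add up to `(√a - √b)² / 2 + (√a + √b - 2√m)² / 2`;
  -- the second square is dropped.
  nlinarith [sq_nonneg (√a + √b - 2 * √((a + b) / 2))]

/-- Cruder than `-1/e`, but enough to make `t log t + 1` nonnegative. -/
theorem neg_one_le_mul_log {a : ℝ} (ha : 0 ≤ a) : -1 ≤ a * Real.log a := by
  have h := mul_log_add_le ha zero_le_one (fun h => absurd h one_ne_zero)
  simp only [Real.log_one, Real.sqrt_one] at h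
  nlinarith [Real.sq_sqrt ha, sq_nonneg (√a - 1), sq_nonneg (√a)]

/-- Young's inequality with weight `ε` for `(√a - √b)(√a + √b)`. Once integrated, it bounds the `L¹`
distance by the Hellinger distance without Cauchy–Schwarz. -/
theorem abs_sub_le_sqrt_sub_sq {a b ε : ℝ} (ha : 0 ≤ a) (hb : 0 ≤ b) (hε : 0 < ε) :
    |a - b| ≤ 1 / (2 * ε) * (√a - √b) ^ 2 + ε * (a + b) := by
  have h : 2 * ε * |a - b| ≤ (√a - √b) ^ 2 + 2 * ε ^ 2 * (a + b) := by
    have e : a - b = (√a - √b) * (√a + √b) := by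
      nlinarith [Real.sq_sqrt ha, Real.sq_sqrt hb]
    have e2 : (√a + √b) ^ 2 ≤ 2 * (a + b) := by
      nlinarith [Real.sq_sqrt ha, Real.sq_sqrt hb, sq_nonneg (√a - √b)]
    have e3 : 2 * ε * |a - b| ≤ (√a - √b) ^ 2 + ε ^ 2 * (√a + √b) ^ 2 := by
      rw [e]
      rcases abs_cases ((√a - √b) * (√a + √b)) with ⟨h, -⟩ | ⟨h, -⟩ <;> rw [h] <;>
        nlinarith [sq_nonneg ((√a - √b) - ε * (√a + √b)), sq_nonneg ((√a - √b) + ε * (√a + √b))]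
    nlinarith [mul_le_mul_of_nonneg_left e2 (sq_nonneg ε)]
  have h2 : 1 / (2 * ε) * (√a - √b) ^ 2 + ε * (a + b) =
      ((√a - √b) ^ 2 + 2 * ε ^ 2 * (a + b)) / (2 * ε) := by
    field_simp
  rw [h2, le_div_iff₀ (by positivity)]
  linarith

/-! ### Densities, the shifted entropy and its uniform midpoint convexity. -/

noncomputable section

variable {X : Type*} [MeasurableSpace X]

/-- The midpoint of two probability measures. -/
def probabilityMidpoint (ρ σ : ProbabilityMeasure X) : ProbabilityMeasure X :=
  ⟨(2⁻¹ : ℝ≥0∞) • ((ρ : Measure X) + σ), ⟨by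
    simp [ENNReal.inv_two_add_inv_two]⟩⟩

theorem probabilityMidpoint_toMeasure (ρ σ : ProbabilityMeasure X) :
    (probabilityMidpoint ρ σ : Measure X) = (2⁻¹ : ℝ≥0∞) • ((ρ : Measure X) + σ) := rfl

theorem two_mul_lintegral_probabilityMidpoint (ρ σ : ProbabilityMeasure X) (g : X → ℝ≥0∞) :
    2 * ∫⁻ x, g x ∂(probabilityMidpoint ρ σ : Measure X) =
      ∫⁻ x, g x ∂(ρ : Measure X) + ∫⁻ x, g x ∂(σ : Measure X) := by
  rw [probabilityMidpoint_toMeasure, lintegral_smul_measure, lintegral_add_measure, smul_eq_mul,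
    ← mul_assoc, ENNReal.mul_inv_cancel (by simp) (by simp), one_mul]

/-- The density of a measure, as a real function. -/
def realDensity (μ : Measure X) (ρ : ProbabilityMeasure X) (x : X) : ℝ :=
  ((ρ : Measure X).rnDeriv μ x).toReal

variable {μ : Measure X}

theorem realDensity_nonneg (ρ : ProbabilityMeasure X) (x : X) : 0 ≤ realDensity μ ρ x :=
  ENNReal.toReal_nonneg

theorem measurable_realDensity (ρ : ProbabilityMeasure X) : Measurable (realDensity μ ρ) :=
  (Measure.measurable_rnDeriv _ _).ennreal_toReal

theorem ofReal_realDensity_ae (ρ : ProbabilityMeasure X) :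
    (fun x => ENNReal.ofReal (realDensity μ ρ x)) =ᵐ[μ] (ρ : Measure X).rnDeriv μ := by
  filter_upwards [Measure.rnDeriv_lt_top (ρ : Measure X) μ] with x hx
  exact ENNReal.ofReal_toReal hx.ne

theorem probabilityMidpoint_absolutelyContinuous {ρ σ : ProbabilityMeasure X}
    (hρ : (ρ : Measure X) ≪ μ) (hσ : (σ : Measure X) ≪ μ) :
    (probabilityMidpoint ρ σ : Measure X) ≪ μ := by
  intro s hs
  simp [probabilityMidpoint_toMeasure, hρ hs, hσ hs]

/-- The entropy, shifted by the total mass of the reference measure so as to be nonnegative. -/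
def shiftedEntropy (μ : Measure X) (ρ : ProbabilityMeasure X) : ℝ≥0∞ :=
  ∫⁻ x, ENNReal.ofReal (realDensity μ ρ x * Real.log (realDensity μ ρ x) + 1) ∂μ

theorem measurable_shiftedEntropy_integrand (ρ : ProbabilityMeasure X) :
    Measurable fun x =>
      ENNReal.ofReal (realDensity μ ρ x * Real.log (realDensity μ ρ x) + 1) := by
  have := measurable_realDensity (μ := μ) ρ
  fun_prop

variable [IsFiniteMeasure μ]

theorem withDensity_realDensity {ρ : ProbabilityMeasure X} (h : (ρ : Measure X) ≪ μ) :
    μ.withDensity (fun x => ENNReal.ofReal (realDensity μ ρ x)) = ρ := by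
  rw [withDensity_congr_ae (ofReal_realDensity_ae ρ), Measure.withDensity_rnDeriv_eq _ _ h]

theorem lintegral_realDensity {ρ : ProbabilityMeasure X} (h : (ρ : Measure X) ≪ μ) :
    ∫⁻ x, ENNReal.ofReal (realDensity μ ρ x) ∂μ = 1 := by
  have := congrArg (fun ν : Measure X => ν Set.univ) (withDensity_realDensity h)
  simpa using this

theorem realDensity_ae_eq {ρ : ProbabilityMeasure X} {f : X → ℝ} (hf : Measurable f)
    (h0 : ∀ᵐ x ∂μ, 0 ≤ f x) (h : (ρ : Measure X) = μ.withDensity (fun x => ENNReal.ofReal (f x))) :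
    realDensity μ ρ =ᵐ[μ] f := by
  have := Measure.rnDeriv_withDensity μ hf.ennreal_ofReal
  rw [← h] at this
  filter_upwards [this, h0] with x hx hx0
  rw [realDensity, hx, ENNReal.toReal_ofReal hx0]

theorem realDensity_probabilityMidpoint {ρ σ : ProbabilityMeasure X}
    (hρ : (ρ : Measure X) ≪ μ) (hσ : (σ : Measure X) ≪ μ) :
    realDensity μ (probabilityMidpoint ρ σ) =ᵐ[μ]
      fun x => (realDensity μ ρ x + realDensity μ σ x) / 2 := by
  have m1 := measurable_realDensity (μ := μ) ρ
  have m2 := measurable_realDensity (μ := μ) σ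
  refine realDensity_ae_eq ((m1.add m2).div_const 2)
    (.of_forall fun x => ?_) ?_
  · have := realDensity_nonneg (μ := μ) ρ x
    have := realDensity_nonneg (μ := μ) σ x
    positivity
  · rw [probabilityMidpoint_toMeasure]
    conv_lhs => rw [← withDensity_realDensity hρ, ← withDensity_realDensity hσ,
      ← withDensity_add_left m1.ennreal_ofReal, ← withDensity_smul' _ _ (by simp)]
    congr 1
    ext x
    simp only [Pi.smul_apply, Pi.add_apply, smul_eq_mul]
    rw [← ENNReal.ofReal_add (realDensity_nonneg _ _) (realDensity_nonneg _ _), div_eq_inv_mul,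
      ENNReal.ofReal_mul (by norm_num), ENNReal.ofReal_inv_of_pos (by norm_num)]
    simp

/-- The pointwise inequality is integrated; the shifts by 1 balance, two on each side. The defect is
kept, since it is the source of both compactness and uniqueness. -/
theorem shiftedEntropy_midpoint_le {ρ σ : ProbabilityMeasure X}
    (hρ : (ρ : Measure X) ≪ μ) (hσ : (σ : Measure X) ≪ μ) :
    2 * shiftedEntropy μ (probabilityMidpoint ρ σ) +
      ∫⁻ x, ENNReal.ofReal ((√(realDensity μ ρ x) - √(realDensity μ σ x)) ^ 2 / 2) ∂μ ≤
      shiftedEntropy μ ρ + shiftedEntropy μ σ := by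
  unfold shiftedEntropy
  rw [← lintegral_const_mul _ (measurable_shiftedEntropy_integrand _),
    ← lintegral_add_left ((measurable_shiftedEntropy_integrand _).const_mul 2),
    ← lintegral_add_left (measurable_shiftedEntropy_integrand _)]
  refine lintegral_mono_ae ?_
  filter_upwards [realDensity_probabilityMidpoint hρ hσ] with x hx
  have h1 := realDensity_nonneg (μ := μ) ρ x
  have h2 := realDensity_nonneg (μ := μ) σ x
  have h := mul_log_midpoint_le h1 h2
  have k := neg_one_le_mul_log (a := (realDensity μ ρ x + realDensity μ σ x) / 2) (by positivity)
  have k1 := neg_one_le_mul_log h1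
  have k2 := neg_one_le_mul_log h2
  rw [hx, show (2 : ℝ≥0∞) = ENNReal.ofReal 2 by simp, ← ENNReal.ofReal_mul (by norm_num),
    ← ENNReal.ofReal_add (by linarith) (by positivity),
    ← ENNReal.ofReal_add (by linarith) (by linarith)]
  exact ENNReal.ofReal_le_ofReal (by linarith)

theorem lintegral_enorm_realDensity_sub_le {ρ σ : ProbabilityMeasure X}
    (hρ : (ρ : Measure X) ≪ μ) (hσ : (σ : Measure X) ≪ μ) {ε : ℝ} (hε : 0 < ε) :
    ∫⁻ x, ‖realDensity μ ρ x - realDensity μ σ x‖ₑ ∂μ ≤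
      ENNReal.ofReal (1 / ε) *
        ∫⁻ x, ENNReal.ofReal ((√(realDensity μ ρ x) - √(realDensity μ σ x)) ^ 2 / 2) ∂μ +
      ENNReal.ofReal (2 * ε) := by
  have m1 := measurable_realDensity (μ := μ) ρ
  have m2 := measurable_realDensity (μ := μ) σ
  have e : ENNReal.ofReal (2 * ε) = ∫⁻ x, ENNReal.ofReal ε *
      (ENNReal.ofReal (realDensity μ ρ x) + ENNReal.ofReal (realDensity μ σ x)) ∂μ := by
    rw [lintegral_const_mul _ (by fun_prop), lintegral_add_left (by fun_prop),
      lintegral_realDensity hρ, lintegral_realDensity hσ, mul_comm 2,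
      ENNReal.ofReal_mul hε.le, one_add_one_eq_two]
    simp
  rw [e, ← lintegral_const_mul _ (by fun_prop), ← lintegral_add_left (by fun_prop)]
  refine lintegral_mono fun x => ?_
  have h1 := realDensity_nonneg (μ := μ) ρ x
  have h2 := realDensity_nonneg (μ := μ) σ x
  rw [Real.enorm_eq_ofReal_abs, ← ENNReal.ofReal_add h1 h2, ← ENNReal.ofReal_mul hε.le,
    ← ENNReal.ofReal_mul (by positivity), ← ENNReal.ofReal_add (by positivity) (by positivity)]
  refine ENNReal.ofReal_le_ofReal ((abs_sub_le_sqrt_sub_sq h1 h2 hε).trans_eq ?_)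
  field_simp

end

/-! ### Minimization of the entropy plus a convex Lipschitz penalty. -/

noncomputable section

variable {X : Type*} [MeasurableSpace X] {μ : Measure X}

open Classical in
/-- The shifted entropy plus a penalization, extended by `+∞` to singular measures. -/
def penalizedEntropy (μ : Measure X) (G : ProbabilityMeasure X → ℝ≥0∞)
    (ρ : ProbabilityMeasure X) : ℝ≥0∞ :=
  if (ρ : Measure X) ≪ μ then shiftedEntropy μ ρ + G ρ else ⊤

theorem penalizedEntropy_of_ac {G : ProbabilityMeasure X → ℝ≥0∞} {ρ : ProbabilityMeasure X}
    (h : (ρ : Measure X) ≪ μ) : penalizedEntropy μ G ρ = shiftedEntropy μ ρ + G ρ :=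
  if_pos h

theorem ac_of_penalizedEntropy_lt_top {G : ProbabilityMeasure X → ℝ≥0∞} {ρ : ProbabilityMeasure X}
    (h : penalizedEntropy μ G ρ ≠ ⊤) : (ρ : Measure X) ≪ μ := by
  by_contra hn
  exact h (if_neg hn)

/-- Fatou's lemma, available because the shifted integrand is nonnegative and `t log t` is
continuous up to `t = 0`. -/
theorem shiftedEntropy_le_liminf {ρ : ℕ → ProbabilityMeasure X} {σ : ProbabilityMeasure X}
    (h : ∀ᵐ x ∂μ, Tendsto (fun i => realDensity μ (ρ i) x) atTop (𝓝 (realDensity μ σ x))) :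
    shiftedEntropy μ σ ≤ liminf (fun i => shiftedEntropy μ (ρ i)) atTop := by
  refine le_trans (le_of_eq ?_)
    (lintegral_liminf_le fun i => measurable_shiftedEntropy_integrand (ρ i))
  refine lintegral_congr_ae ?_
  filter_upwards [h] with x hx
  have hc : Continuous fun t : ℝ => ENNReal.ofReal (t * Real.log t + 1) :=
    ENNReal.continuous_ofReal.comp (Real.continuous_mul_log.add continuous_const)
  exact ((hc.tendsto _).comp hx).liminf_eq.symm

variable [IsFiniteMeasure μ]

/-- The normalized reference measure has constant density, hence finite entropy. This makes the
infimum finite, so that it can be cancelled later. -/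
theorem exists_penalizedEntropy_ne_top (hμ : μ ≠ 0) {G : ProbabilityMeasure X → ℝ≥0∞}
    (hG : ∀ ρ, G ρ ≠ ⊤) : ∃ ρ, penalizedEntropy μ G ρ ≠ ⊤ := by
  have hμ0 : μ Set.univ ≠ 0 := by simpa using hμ
  have hμt : μ Set.univ ≠ ⊤ := measure_ne_top _ _
  set c : ℝ := ((μ Set.univ)⁻¹).toReal with hc
  have hc' : ENNReal.ofReal c = (μ Set.univ)⁻¹ := ENNReal.ofReal_toReal (by simpa using hμ)
  let ρ : ProbabilityMeasure X := ⟨μ.withDensity fun _ => ENNReal.ofReal c, ⟨by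
    simp [hc', ENNReal.inv_mul_cancel hμ0 hμt]⟩⟩
  have hρ : (ρ : Measure X) ≪ μ := withDensity_absolutelyContinuous _ _
  refine ⟨ρ, ?_⟩
  rw [penalizedEntropy_of_ac hρ]
  refine ENNReal.add_ne_top.2 ⟨?_, hG ρ⟩
  have h : realDensity μ ρ =ᵐ[μ] fun _ => c :=
    realDensity_ae_eq measurable_const (.of_forall fun _ => ENNReal.toReal_nonneg) rfl
  have : shiftedEntropy μ ρ = ∫⁻ _, ENNReal.ofReal (c * Real.log c + 1) ∂μ := by
    refine lintegral_congr_ae ?_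
    filter_upwards [h] with x hx
    rw [hx]
  rw [this, lintegral_const]
  exact ENNReal.mul_ne_top ENNReal.ofReal_ne_top hμt

theorem probabilityMeasure_eq_of_lintegral_eq_zero {ρ σ : ProbabilityMeasure X}
    (hρ : (ρ : Measure X) ≪ μ) (hσ : (σ : Measure X) ≪ μ)
    (h : ∫⁻ x, ‖realDensity μ ρ x - realDensity μ σ x‖ₑ ∂μ = 0) : ρ = σ := by
  have m1 := measurable_realDensity (μ := μ) ρ
  have m2 := measurable_realDensity (μ := μ) σ
  rw [lintegral_eq_zero_iff (by fun_prop)] at h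
  apply Subtype.ext
  change (ρ : Measure X) = σ
  rw [← withDensity_realDensity hρ, ← withDensity_realDensity hσ]
  refine withDensity_congr_ae ?_
  filter_upwards [h] with x hx
  have : realDensity μ ρ x = realDensity μ σ x := by simpa [sub_eq_zero] using hx
  rw [this]

theorem penalizedEntropy_midpoint_le {G : ProbabilityMeasure X → ℝ≥0∞}
    (hconv : ∀ ρ σ, 2 * G (probabilityMidpoint ρ σ) ≤ G ρ + G σ)
    {ρ σ : ProbabilityMeasure X}
    (hρ : (ρ : Measure X) ≪ μ) (hσ : (σ : Measure X) ≪ μ) :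
    2 * penalizedEntropy μ G (probabilityMidpoint ρ σ) +
      ∫⁻ x, ENNReal.ofReal ((√(realDensity μ ρ x) - √(realDensity μ σ x)) ^ 2 / 2) ∂μ ≤
      penalizedEntropy μ G ρ + penalizedEntropy μ G σ := by
  rw [penalizedEntropy_of_ac hρ, penalizedEntropy_of_ac hσ,
    penalizedEntropy_of_ac (probabilityMidpoint_absolutelyContinuous hρ hσ)]
  calc _ = (2 * shiftedEntropy μ (probabilityMidpoint ρ σ) +
      ∫⁻ x, ENNReal.ofReal ((√(realDensity μ ρ x) - √(realDensity μ σ x)) ^ 2 / 2) ∂μ) +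
      2 * G (probabilityMidpoint ρ σ) := by ring
    _ ≤ (shiftedEntropy μ ρ + shiftedEntropy μ σ) + (G ρ + G σ) :=
      add_le_add (shiftedEntropy_midpoint_le hρ hσ) (hconv ρ σ)
    _ = _ := by ring

/-- Two almost minimizers are close in total variation. -/
theorem lintegral_enorm_sub_le_of_almost_minimizers {G : ProbabilityMeasure X → ℝ≥0∞}
    (hconv : ∀ ρ σ, 2 * G (probabilityMidpoint ρ σ) ≤ G ρ + G σ)
    {I : ℝ≥0∞} (hI : I ≠ ⊤)
    (hmin : ∀ ρ, I ≤ penalizedEntropy μ G ρ) {ε : ℝ} (hε : 0 < ε) {ρ σ : ProbabilityMeasure X}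
    (hρ : penalizedEntropy μ G ρ ≤ I + ENNReal.ofReal (ε ^ 2))
    (hσ : penalizedEntropy μ G σ ≤ I + ENNReal.ofReal (ε ^ 2)) :
    ∫⁻ x, ‖realDensity μ ρ x - realDensity μ σ x‖ₑ ∂μ ≤ ENNReal.ofReal (4 * ε) := by
  have hρ' : (ρ : Measure X) ≪ μ :=
    ac_of_penalizedEntropy_lt_top (ne_top_of_le_ne_top (by finiteness) hρ)
  have hσ' : (σ : Measure X) ≪ μ :=
    ac_of_penalizedEntropy_lt_top (ne_top_of_le_ne_top (by finiteness) hσ)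
  have key := (penalizedEntropy_midpoint_le hconv hρ' hσ').trans (add_le_add hρ hσ)
  -- The midpoint is a competitor, so twice its value is at least `2 * I`; subtracting this leaves
  -- only the two tolerances `ε²`.
  have hH : ∫⁻ x, ENNReal.ofReal ((√(realDensity μ ρ x) - √(realDensity μ σ x)) ^ 2 / 2) ∂μ ≤
      ENNReal.ofReal (2 * ε ^ 2) := by
    have h2I : 2 * I ≠ ⊤ := by finiteness
    refine (ENNReal.add_le_add_iff_left h2I).1 ?_
    calc _ ≤ _ := add_le_add_left (mul_le_mul_right (hmin (probabilityMidpoint ρ σ)) 2) _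
      _ ≤ _ := key
      _ = _ := by
        rw [ENNReal.ofReal_mul (by norm_num)]
        simp only [ENNReal.ofReal_ofNat]
        ring
  refine (lintegral_enorm_realDensity_sub_le hρ' hσ' hε).trans ?_
  calc _ ≤ ENNReal.ofReal (1 / ε) * ENNReal.ofReal (2 * ε ^ 2) + ENNReal.ofReal (2 * ε) := by
        gcongr
    _ = _ := by
      rw [← ENNReal.ofReal_mul (by positivity), ← ENNReal.ofReal_add (by positivity) (by positivity)]
      congr 1
      field_simp
      ring

/-- A sequence of absolutely continuous measures whose densities are rapidly Cauchy in `L¹`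
has a subsequence that converges, in `L¹` and almost everywhere, to a probability measure. -/
theorem exists_limit_of_cauchy {ρ : ℕ → ProbabilityMeasure X}
    (hρ : ∀ n, (ρ n : Measure X) ≪ μ) {B : ℕ → ℝ≥0∞} (hB : ∑' i, B i ≠ ⊤)
    (hcau : ∀ N n m, N ≤ n → N ≤ m →
      ∫⁻ x, ‖realDensity μ (ρ n) x - realDensity μ (ρ m) x‖ₑ ∂μ < B N) :
    ∃ (σ : ProbabilityMeasure X) (ns : ℕ → ℕ), (σ : Measure X) ≪ μ ∧ StrictMono ns ∧
      Tendsto (fun n => ∫⁻ x, ‖realDensity μ (ρ n) x - realDensity μ σ x‖ₑ ∂μ) atTop (𝓝 0) ∧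
      ∀ᵐ x ∂μ, Tendsto (fun i => realDensity μ (ρ (ns i)) x) atTop (𝓝 (realDensity μ σ x)) := by
  have mρ := fun n => measurable_realDensity (μ := μ) (ρ n)
  have hL : ∀ n, MemLp (realDensity μ (ρ n)) 1 μ := fun n => by
    rw [memLp_one_iff_integrable]
    refine ⟨(mρ n).aestronglyMeasurable, ?_⟩
    rw [hasFiniteIntegral_iff_ofReal (.of_forall fun x => realDensity_nonneg _ _),
      lintegral_realDensity (hρ n)]
    exact ENNReal.one_lt_top
  obtain ⟨g, hg, hlim⟩ := Lp.cauchy_complete_eLpNorm le_rfl hL hB (fun N n m h1 h2 => by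
    rw [eLpNorm_one_eq_lintegral_enorm]
    exact hcau N n m h1 h2)
  obtain ⟨ns, hns, hae⟩ := (tendstoInMeasure_of_tendsto_eLpNorm one_ne_zero
    (fun n => (hL n).1) hg.1 hlim).exists_seq_tendsto_ae
  -- The `L¹` limit is only almost everywhere measurable; a measurable representative serves as a
  -- density.
  obtain ⟨f, mf, hfg⟩ := hg.1.aemeasurable
  have hf0 : ∀ᵐ x ∂μ, 0 ≤ f x := by
    filter_upwards [hae, hfg] with x hx hfx
    rw [← hfx]
    exact ge_of_tendsto' hx fun i => realDensity_nonneg _ _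
  have hlim' : Tendsto (fun n => ∫⁻ x, ‖realDensity μ (ρ n) x - f x‖ₑ ∂μ) atTop (𝓝 0) := by
    refine hlim.congr fun n => ?_
    rw [eLpNorm_one_eq_lintegral_enorm]
    refine lintegral_congr_ae ?_
    filter_upwards [hfg] with x hx
    simp [hx]
  -- Total mass passes to the limit, by the `L¹` triangle inequality in both directions.
  have hone : ∫⁻ x, ENNReal.ofReal (f x) ∂μ = 1 := by
    have hle : ∀ a b : ℝ, ENNReal.ofReal a ≤ ENNReal.ofReal b + ‖a - b‖ₑ := fun a b => by
      rw [Real.enorm_eq_ofReal_abs]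
      refine (ENNReal.ofReal_le_ofReal ?_).trans ENNReal.ofReal_add_le
      linarith [le_abs_self (a - b)]
    have hlim1 := hlim'.const_add 1
    rw [add_zero] at hlim1
    apply le_antisymm
    · refine ge_of_tendsto' hlim1 fun n => ?_
      rw [← lintegral_realDensity (hρ n), ← lintegral_add_left (mρ n).ennreal_ofReal]
      refine lintegral_mono fun x => ?_
      rw [enorm_sub_rev]
      exact hle _ _
    · have h2 := hlim'.const_add (∫⁻ x, ENNReal.ofReal (f x) ∂μ)
      rw [add_zero] at h2
      refine ge_of_tendsto' h2 fun n => ?_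
      rw [← lintegral_realDensity (hρ n), ← lintegral_add_left mf.ennreal_ofReal]
      exact lintegral_mono fun x => hle _ _
  let σ : ProbabilityMeasure X := ⟨μ.withDensity fun x => ENNReal.ofReal (f x), ⟨by simpa⟩⟩
  have hσ : realDensity μ σ =ᵐ[μ] f := realDensity_ae_eq mf hf0 rfl
  refine ⟨σ, ns, withDensity_absolutelyContinuous _ _, hns, hlim'.congr fun n => ?_, ?_⟩
  · refine lintegral_congr_ae ?_
    filter_upwards [hσ] with x hx
    rw [hx]
  · filter_upwards [hae, hfg, hσ] with x h1 h2 h3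
    rwa [h3, ← h2]

/-- Existence and uniqueness of the minimizer of the entropy plus a penalization that is finite,
midpoint convex, and Lipschitz in total variation. -/
theorem existsUnique_minimizer_penalizedEntropy (hμ : μ ≠ 0) {G : ProbabilityMeasure X → ℝ≥0∞}
    (hfin : ∀ ρ, G ρ ≠ ⊤)
    (hconv : ∀ ρ σ, 2 * G (probabilityMidpoint ρ σ) ≤ G ρ + G σ) {C : ℝ≥0∞} (hC : C ≠ ⊤)
    (hlip : ∀ ρ σ : ProbabilityMeasure X, (ρ : Measure X) ≪ μ → (σ : Measure X) ≪ μ →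
      G ρ ≤ G σ + C * ∫⁻ x, ‖realDensity μ ρ x - realDensity μ σ x‖ₑ ∂μ) :
    ∃! ρ, ∀ σ, penalizedEntropy μ G ρ ≤ penalizedEntropy μ G σ := by
  set F := penalizedEntropy μ G with hF
  set I : ℝ≥0∞ := ⨅ ρ, F ρ with hI
  have hmin : ∀ ρ, I ≤ F ρ := fun ρ => iInf_le _ ρ
  have hIt : I ≠ ⊤ := by
    obtain ⟨ρ, h⟩ := exists_penalizedEntropy_ne_top hμ hfin
    exact ne_top_of_le_ne_top h (hmin ρ)
  have hpos : ∀ n : ℕ, (0 : ℝ) < (1 / 2) ^ n := fun n => by positivity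
  -- The tolerance is the square of `2⁻ⁿ` because a gap of `ε²` gives an `L¹` distance of order `ε`,
  -- which must be summable.
  have hex : ∀ n : ℕ, ∃ ρ, F ρ < I + ENNReal.ofReal (((1 / 2) ^ n) ^ 2) := fun n =>
    iInf_lt_iff.1 (ENNReal.lt_add_right hIt
      (ENNReal.ofReal_pos.2 (pow_pos (hpos n) 2)).ne')
  choose ρ hρ using hex
  have hac : ∀ n, (ρ n : Measure X) ≪ μ := fun n => ac_of_penalizedEntropy_lt_top (hρ n).ne_top
  have hmono : ∀ N n : ℕ, N ≤ n → F (ρ n) ≤ I + ENNReal.ofReal (((1 / 2) ^ N) ^ 2) :=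
    fun N n h => (hρ n).le.trans (add_le_add_right (ENNReal.ofReal_le_ofReal
      (pow_le_pow_left₀ (hpos n).le (pow_le_pow_of_le_one (by norm_num) (by norm_num) h) 2)) _)
  -- Almost minimizers are within `4 * 2⁻ᴺ`; the factor 5 provides the strict inequality in the
  -- Cauchy criterion.
  have hB : ∑' N : ℕ, ENNReal.ofReal (5 * (1 / 2) ^ N) ≠ ⊤ := by
    rw [← ENNReal.ofReal_tsum_of_nonneg (fun n => by positivity)
      (summable_geometric_two.mul_left 5)]
    exact ENNReal.ofReal_ne_top
  obtain ⟨σ, ns, hσ, hns, hL, hae⟩ := exists_limit_of_cauchy hac hB fun N n m h1 h2 =>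
    (lintegral_enorm_sub_le_of_almost_minimizers hconv hIt hmin (hpos N) (hmono N n h1)
      (hmono N m h2)).trans_lt
      ((ENNReal.ofReal_lt_ofReal_iff (by positivity)).2 (by linarith [hpos N]))
  -- The Lipschitz bound replaces `G (ρ n)` by `G σ` at a cost that tends to zero, so only the
  -- entropy needs lower semicontinuity.
  have hbound : ∀ n, shiftedEntropy μ (ρ n) + G σ ≤ I + ENNReal.ofReal (((1 / 2) ^ n) ^ 2) +
      C * ∫⁻ x, ‖realDensity μ (ρ n) x - realDensity μ σ x‖ₑ ∂μ := fun n => by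
    have h1 := hlip σ (ρ n) hσ (hac n)
    simp_rw [enorm_sub_rev (realDensity μ σ _)] at h1
    have h2 := (hρ n).le
    rw [hF, penalizedEntropy_of_ac (hac n)] at h2
    calc _ ≤ _ := add_le_add_right h1 _
      _ = _ := (add_assoc _ _ _).symm
      _ ≤ _ := add_le_add_left h2 _
  have hlimit : Tendsto (fun n => I + ENNReal.ofReal (((1 / 2) ^ n) ^ 2) +
      C * ∫⁻ x, ‖realDensity μ (ρ n) x - realDensity μ σ x‖ₑ ∂μ) atTop (𝓝 I) := by
    have h1 : Tendsto (fun n : ℕ => ENNReal.ofReal (((1 / 2) ^ n) ^ 2)) atTop (𝓝 0) := by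
      simpa using ENNReal.tendsto_ofReal ((tendsto_pow_atTop_nhds_zero_of_lt_one
        (r := (1 / 2 : ℝ)) (by norm_num) (by norm_num)).pow 2)
    have h2 := ENNReal.Tendsto.const_mul hL (Or.inr hC)
    simpa using (h1.const_add I).add h2
  -- Needed for the truncated subtraction `I - G σ` to be undone at the end.
  have hGI : G σ ≤ I := ge_of_tendsto' hlimit fun n => le_add_self.trans (hbound n)
  have hE : shiftedEntropy μ σ ≤ I - G σ := by
    have h1 := (ENNReal.Tendsto.sub hlimit tendsto_const_nhds (Or.inl hIt) :
      Tendsto _ atTop (𝓝 (I - G σ))).comp hns.tendsto_atTop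
    rw [← h1.liminf_eq]
    refine (shiftedEntropy_le_liminf hae).trans (liminf_le_liminf (.of_forall fun i => ?_))
    exact ENNReal.le_sub_of_add_le_right (hfin σ) (hbound (ns i))
  have hFσ : F σ ≤ I := by
    rw [hF, penalizedEntropy_of_ac hσ]
    exact (add_le_add_left hE _).trans (tsub_add_cancel_of_le hGI).le
  refine ⟨σ, fun τ => hFσ.trans (hmin τ), fun τ hτ => ?_⟩
  -- Uniqueness: two minimizers are almost minimizers for every tolerance, so their `L¹` distance is
  -- zero.
  have hFτ : F τ ≤ I := (hτ σ).trans hFσ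
  refine probabilityMeasure_eq_of_lintegral_eq_zero (μ := μ)
    (ac_of_penalizedEntropy_lt_top (ne_top_of_le_ne_top hIt hFτ)) hσ ?_
  have h0 : Tendsto (fun n : ℕ => ENNReal.ofReal (4 * (1 / 2) ^ n)) atTop (𝓝 0) := by
    simpa only [mul_zero, ENNReal.ofReal_zero] using ENNReal.tendsto_ofReal
      ((tendsto_pow_atTop_nhds_zero_of_lt_one (r := (1 / 2 : ℝ)) (by norm_num)
        (by norm_num)).const_mul 4)
  exact le_antisymm (ge_of_tendsto' h0 fun n => lintegral_enorm_sub_le_of_almost_minimizers hconv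
    hIt hmin (hpos n) (hFτ.trans le_self_add) (hFσ.trans le_self_add)) zero_le

end

/-! ### Convexity and total variation continuity of the transport cost. -/

noncomputable section

variable {X : Type*} [MeasurableSpace X]

/-- The optimal transport cost for a general cost function. -/
def transportCost (c : X × X → ℝ≥0∞) (ρ σ : ProbabilityMeasure X) : ℝ≥0∞ :=
  ⨅ γ ∈ transportPlans ρ σ, ∫⁻ z, c z ∂(γ : Measure (X × X))

theorem wasserstein2_sq [PseudoEMetricSpace X] (ρ σ : ProbabilityMeasure X) :
    wasserstein2 ρ σ ^ 2 = transportCost (fun z => edist z.1 z.2 ^ 2) ρ σ := by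
  rw [wasserstein2, ← ENNReal.rpow_natCast, ← ENNReal.rpow_mul]
  norm_num [transportCost]

theorem transportCost_le {c : X × X → ℝ≥0∞} {D : ℝ≥0∞} (hc : ∀ z, c z ≤ D)
    (ρ σ : ProbabilityMeasure X) : transportCost c ρ σ ≤ D := by
  let γ : ProbabilityMeasure (X × X) := ⟨(ρ : Measure X).prod σ, inferInstance⟩
  refine (iInf₂_le γ ⟨?_, ?_⟩).trans ?_
  · refine (lintegral_mono hc).trans ?_
    simp
  · simp [γ]
  · simp [γ]

/-- The midpoint of two plans with common second marginal `σ` is admissible for the midpoint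
measure, and the cost is linear in the plan. -/
theorem transportCost_midpoint_le (c : X × X → ℝ≥0∞) (σ ρ ρ' : ProbabilityMeasure X) :
    2 * transportCost c (probabilityMidpoint ρ ρ') σ ≤
      transportCost c ρ σ + transportCost c ρ' σ := by
  refine ENNReal.le_iInf₂_add_iInf₂ fun γ hγ γ' hγ' => ?_
  rw [← two_mul_lintegral_probabilityMidpoint]
  refine mul_le_mul_right (iInf₂_le _ ⟨?_, ?_⟩) _
  · rw [probabilityMidpoint_toMeasure, probabilityMidpoint_toMeasure, Measure.map_smul,
      Measure.map_add _ _ measurable_fst, hγ.1, hγ'.1]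
  · rw [probabilityMidpoint_toMeasure, Measure.map_smul,
      Measure.map_add _ _ measurable_snd, hγ.2, hγ'.2, smul_add, ← add_smul,
      ENNReal.inv_two_add_inv_two, one_smul]

theorem map_withDensity_comp {Y Z : Type*} [MeasurableSpace Y] [MeasurableSpace Z] (ν : Measure Y)
    {g : Y → Z} (hg : Measurable g) {θ : Z → ℝ≥0∞} (hθ : Measurable θ) :
    (ν.withDensity fun y => θ (g y)).map g = (ν.map g).withDensity θ := by
  ext s hs
  rw [Measure.map_apply hg hs, withDensity_apply _ (hg hs), withDensity_apply _ hs,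
    setLIntegral_map hs hθ hg]

/-- Given a plan for the first measure, a plan for the second one is obtained by keeping the common
mass and transporting the remaining mass by a product coupling. -/
theorem exists_transportPlan_le {μ : Measure X} [IsFiniteMeasure μ] {c : X × X → ℝ≥0∞}
    {D : ℝ≥0∞} (hcD : ∀ z, c z ≤ D) {ρ ρ' σ : ProbabilityMeasure X} {p p' : X → ℝ≥0∞}
    (hp : Measurable p) (hp' : Measurable p') (hpt : ∀ x, p' x ≠ ⊤)
    (hρ : (ρ : Measure X) = μ.withDensity p) (hρ' : (ρ' : Measure X) = μ.withDensity p')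
    {γ : ProbabilityMeasure (X × X)} (hγ : γ ∈ transportPlans ρ' σ) :
    ∃ γ' ∈ transportPlans ρ σ, ∫⁻ z, c z ∂(γ' : Measure (X × X)) ≤
      ∫⁻ z, c z ∂(γ : Measure (X × X)) + D * ∫⁻ x, (p x - p' x) ∂μ := by
  -- The fraction of the mass of `ρ'` at `x` that `ρ` also has. Where `p'` vanishes the convention
  -- `0 / 0 = 0` applies, which is harmless as only `p' * θ` matters.
  set θ : X → ℝ≥0∞ := fun x => min (p x) (p' x) / p' x with hθ
  have mθ : Measurable θ := (hp.min hp').div hp'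
  have hθ1 : ∀ x, θ x ≤ 1 := fun x => ENNReal.div_le_of_le_mul (by simp)
  have hpθ : ∀ x, p' x * θ x = min (p x) (p' x) := fun x => by
    rcases eq_or_ne (p' x) 0 with h | h
    · simp [h]
    · exact ENNReal.mul_div_cancel h (hpt x)
  set γ₁ : Measure (X × X) := (γ : Measure (X × X)).withDensity fun z => θ z.1 with hγ₁
  set γ₂ : Measure (X × X) := (γ : Measure (X × X)).withDensity fun z => 1 - θ z.1 with hγ₂
  have hsum : γ₁ + γ₂ = γ := by
    rw [hγ₁, hγ₂, ← withDensity_add_left (f := fun z : X × X => θ z.1) (by fun_prop)]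
    conv_rhs => rw [← withDensity_one (μ := (γ : Measure (X × X)))]
    congr 1
    ext z
    exact add_tsub_cancel_of_le (hθ1 _)
  have hle₁ : γ₁ ≤ γ := hsum ▸ Measure.le_add_right le_rfl
  have hle₂ : γ₂ ≤ γ := hsum ▸ Measure.le_add_left le_rfl
  have : IsFiniteMeasure γ₁ := isFiniteMeasure_of_le _ hle₁
  have : IsFiniteMeasure γ₂ := isFiniteMeasure_of_le _ hle₂
  -- `κ` is the part of `σ` no longer served once the kept plan `γ₁` is fixed; `η` is the excess of
  -- `ρ` over `ρ'`. Their masses agree, so a normalized product can couple them.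
  set κ : Measure X := γ₂.map Prod.snd with hκ
  set η : Measure X := μ.withDensity fun x => p x - p' x with hη
  have hfst₁ : γ₁.map Prod.fst = μ.withDensity fun x => min (p x) (p' x) := by
    rw [hγ₁, map_withDensity_comp _ measurable_fst mθ, hγ.1, hρ', ← withDensity_mul _ hp' mθ]
    congr 1
    ext x
    exact hpθ x
  have hρsum : γ₁.map Prod.fst + η = ρ := by
    rw [hfst₁, hη, hρ, ← withDensity_add_left (hp.min hp')]
    congr 1
    ext x
    change min (p x) (p' x) + (p x - p' x) = p x
    rcases le_total (p x) (p' x) with h | h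
    · simp [h, tsub_eq_zero_of_le h]
    · simp [h, add_tsub_cancel_of_le]
  have hσsum : γ₁.map Prod.snd + κ = σ := by
    rw [hκ, ← Measure.map_add _ _ measurable_snd, hsum, hγ.2]
  have hηle : η ≤ ρ := hρsum ▸ Measure.le_add_left le_rfl
  have : IsFiniteMeasure η := isFiniteMeasure_of_le _ hηle
  set r : ℝ≥0∞ := η Set.univ with hr
  have hrt : r ≠ ⊤ := measure_ne_top _ _
  have hκr : κ Set.univ = r := by
    have h1 := congrArg (fun ν : Measure X => ν Set.univ) hρsum
    have h2 := congrArg (fun ν : Measure X => ν Set.univ) hσsum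
    simp only [Measure.add_apply, measure_univ] at h1 h2
    have h3 : (γ₁.map Prod.fst) Set.univ = (γ₁.map Prod.snd) Set.univ := by
      rw [Measure.map_apply measurable_fst .univ, Measure.map_apply measurable_snd .univ]
      rfl
    rw [h3, ← h2] at h1
    have hf : (γ₁.map Prod.snd) Set.univ ≠ ⊤ := measure_ne_top _ _
    exact ((ENNReal.add_right_inj hf).1 h1).symm
  -- For `r = 0` the factor `r⁻¹` is infinite, but the measure is then zero and the identity
  -- persists.
  have hscale : ∀ ν : Measure X, ν Set.univ = r → r⁻¹ • r • ν = ν := fun ν hν => by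
    rcases eq_or_ne r 0 with h | h
    · rw [Measure.measure_univ_eq_zero.1 (hν.trans h)]
      simp
    · rw [smul_smul, ENNReal.inv_mul_cancel h hrt, one_smul]
  set γ' : Measure (X × X) := γ₁ + r⁻¹ • η.prod κ with hγ'
  have hfst : γ'.map Prod.fst = ρ := by
    rw [hγ', Measure.map_add _ _ measurable_fst, Measure.map_smul, Measure.map_fst_prod, hκr,
      hscale η rfl, hρsum]
  have hsnd : γ'.map Prod.snd = σ := by
    rw [hγ', Measure.map_add _ _ measurable_snd, Measure.map_smul, Measure.map_snd_prod,
      ← hr, hscale κ hκr, hσsum]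
  have hprob : IsProbabilityMeasure γ' := ⟨by
    have := congrArg (fun ν : Measure X => ν Set.univ) hfst
    simpa [Measure.map_apply measurable_fst MeasurableSet.univ] using this⟩
  refine ⟨⟨γ', hprob⟩, ⟨hfst, hsnd⟩, ?_⟩
  change ∫⁻ z, c z ∂γ' ≤ _
  rw [hγ', lintegral_add_measure]
  refine add_le_add (lintegral_mono' hle₁ le_rfl) ((lintegral_mono hcD).trans ?_)
  rw [lintegral_const]
  refine mul_le_mul_right ?_ D
  have hrη : ∫⁻ x, (p x - p' x) ∂μ = r := by simp [hr, hη]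
  rw [hrη, Measure.smul_apply, smul_eq_mul, ← Set.univ_prod_univ, Measure.prod_prod, hκr, ← hr,
    ← mul_assoc]
  exact mul_le_of_le_one_left zero_le (ENNReal.inv_mul_le_one r)

theorem ofReal_sub_ofReal_le_enorm (a b : ℝ) :
    ENNReal.ofReal a - ENNReal.ofReal b ≤ ‖a - b‖ₑ := by
  rw [tsub_le_iff_left, Real.enorm_eq_ofReal_abs]
  refine (ENNReal.ofReal_le_ofReal ?_).trans ENNReal.ofReal_add_le
  linarith [le_abs_self (a - b)]

/-- Each plan for `ρ'` is turned into one for `ρ`; the rerouted mass is the integral of `(p - p')⁺`,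
at most the `L¹` distance, and each unit of it costs at most `D`. -/
theorem transportCost_le_add {μ : Measure X} [IsFiniteMeasure μ] {c : X × X → ℝ≥0∞} {D : ℝ≥0∞}
    (hc : ∀ z, c z ≤ D) (σ : ProbabilityMeasure X) {ρ ρ' : ProbabilityMeasure X}
    (hρ : (ρ : Measure X) ≪ μ) (hρ' : (ρ' : Measure X) ≪ μ) :
    transportCost c ρ σ ≤ transportCost c ρ' σ +
      D * ∫⁻ x, ‖realDensity μ ρ x - realDensity μ ρ' x‖ₑ ∂μ := by
  conv_rhs => rw [transportCost, ENNReal.iInf₂_add]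
  refine le_iInf₂ fun γ hγ => ?_
  obtain ⟨γ', hγ', hle⟩ := exists_transportPlan_le hc
    (measurable_realDensity (μ := μ) ρ).ennreal_ofReal
    (measurable_realDensity (μ := μ) ρ').ennreal_ofReal (fun _ => ENNReal.ofReal_ne_top)
    (withDensity_realDensity hρ).symm (withDensity_realDensity hρ').symm hγ
  refine (iInf₂_le γ' hγ').trans (hle.trans ?_)
  gcongr
  exact ofReal_sub_ofReal_le_enorm _ _

theorem lintegral_le_add {μ : Measure X} [IsFiniteMeasure μ] {g : X → ℝ≥0∞} (mg : Measurable g)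
    {D : ℝ≥0∞} (hg : ∀ x, g x ≤ D) {ρ ρ' : ProbabilityMeasure X}
    (hρ : (ρ : Measure X) ≪ μ) (hρ' : (ρ' : Measure X) ≪ μ) :
    ∫⁻ x, g x ∂(ρ : Measure X) ≤ ∫⁻ x, g x ∂(ρ' : Measure X) +
      D * ∫⁻ x, ‖realDensity μ ρ x - realDensity μ ρ' x‖ₑ ∂μ := by
  have m1 := measurable_realDensity (μ := μ) ρ
  have m2 := measurable_realDensity (μ := μ) ρ'
  conv_lhs => rw [← withDensity_realDensity hρ]
  conv_rhs => enter [1]; rw [← withDensity_realDensity hρ']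
  rw [lintegral_withDensity_eq_lintegral_mul _ m1.ennreal_ofReal mg,
    lintegral_withDensity_eq_lintegral_mul _ m2.ennreal_ofReal mg,
    ← lintegral_const_mul _ (by fun_prop), ← lintegral_add_left (by fun_prop)]
  refine lintegral_mono fun x => ?_
  simp only [Pi.mul_apply]
  have h := tsub_le_iff_left.1 (ofReal_sub_ofReal_le_enorm (realDensity μ ρ x)
    (realDensity μ ρ' x))
  refine (mul_le_mul_left h _).trans ?_
  rw [add_mul, mul_comm D]
  gcongr
  exact hg x

end

/-! ### Reduction of the `EReal` functionals to penalized entropies, and conclusion. -/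

noncomputable section

theorem extendedIntegral_eq_sub {X : Type*} [MeasurableSpace X] {μ : Measure X}
    [IsFiniteMeasure μ] {h : X → ℝ} (mh : Measurable h) (h1 : ∀ x, -1 ≤ h x) :
    extendedIntegral μ h =
      ((∫⁻ x, ENNReal.ofReal (h x + 1) ∂μ : ℝ≥0∞) : EReal) + ((-(μ.real Set.univ) : ℝ) : EReal) := by
  -- This integrates `h⁺ + 1 = (h + 1) + h⁻`, an identity free of subtraction; since `h⁻ ≤ 1` has
  -- finite integral, it can then be rearranged in `EReal`.
  have key : ∫⁻ x, ENNReal.ofReal (h x) ∂μ + μ Set.univ =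
      ∫⁻ x, ENNReal.ofReal (h x + 1) ∂μ + ∫⁻ x, ENNReal.ofReal (-h x) ∂μ := by
    rw [← lintegral_one, ← lintegral_add_left (by fun_prop), ← lintegral_add_left (by fun_prop)]
    refine lintegral_congr fun x => ?_
    rcases le_total 0 (h x) with h0 | h0
    · rw [ENNReal.ofReal_of_nonpos (neg_nonpos.2 h0), ENNReal.ofReal_add h0 zero_le_one]
      simp
    · rw [ENNReal.ofReal_of_nonpos h0,
        ← ENNReal.ofReal_add (by linarith [h1 x]) (by linarith)]
      simp
  have hneg : ∫⁻ x, ENNReal.ofReal (-h x) ∂μ ≠ ⊤ := by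
    refine ne_top_of_le_ne_top (measure_ne_top μ Set.univ) ?_
    rw [← lintegral_one]
    refine lintegral_mono fun x => ?_
    rw [← ENNReal.ofReal_one]
    exact ENNReal.ofReal_le_ofReal (by linarith [h1 x])
  have hμ : μ Set.univ ≠ ⊤ := measure_ne_top _ _
  rw [extendedIntegral, Measure.real]
  generalize ∫⁻ x, ENNReal.ofReal (h x) ∂μ = a at *
  generalize ∫⁻ x, ENNReal.ofReal (-h x) ∂μ = b at *
  generalize ∫⁻ x, ENNReal.ofReal (h x + 1) ∂μ = e at *
  generalize μ Set.univ = m at *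
  lift b to NNReal using hneg
  lift m to NNReal using hμ
  induction a with
  | top =>
    have : e = ⊤ := by
      by_contra he
      exact absurd key (by simpa using (ENNReal.add_ne_top.2 ⟨he, ENNReal.coe_ne_top⟩).symm)
    subst this
    rfl
  | coe a =>
    have : e ≠ ⊤ := fun he => by simp [he, ← ENNReal.coe_add] at key
    lift e to NNReal using this
    have k : (a : ℝ) + m = e + b := by exact_mod_cast key
    change (((a : ℝ) : EReal)) - ((b : ℝ) : EReal) = ((e : ℝ) : EReal) + _
    rw [ENNReal.coe_toReal, ← EReal.coe_sub, ← EReal.coe_add]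
    congr 1
    linarith

theorem coe_integral_eq_sub {X : Type*} [MeasurableSpace X] (ρ : ProbabilityMeasure X) {v : X → ℝ}
    (mv : Measurable v) {M : ℝ} (hM : ∀ x, |v x| ≤ M) :
    ((∫ x, v x ∂(ρ : Measure X) : ℝ) : EReal) =
      ((∫⁻ x, ENNReal.ofReal (v x + M) ∂(ρ : Measure X) : ℝ≥0∞) : EReal) + ((-M : ℝ) : EReal) := by
  have hi : Integrable v (ρ : Measure X) :=
    .of_bound mv.aestronglyMeasurable M (.of_forall hM)
  have h0 : ∀ x, 0 ≤ v x + M := fun x => by linarith [neg_le_of_abs_le (hM x)]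
  have hsum : ∫ x, (v x + M) ∂(ρ : Measure X) = ∫ x, v x ∂(ρ : Measure X) + M := by
    rw [integral_add hi (integrable_const M)]
    simp
  rw [← ofReal_integral_eq_lintegral_ofReal (f := fun x => v x + M) (hi.add (integrable_const M))
    (.of_forall h0), EReal.coe_ennreal_ofReal, max_eq_left (integral_nonneg h0), hsum,
    ← EReal.coe_add, add_neg_cancel_right]

section Domain

variable {d : ℕ} {Ω : Set (EuclideanSpace ℝ (Fin d))}

theorem IsClosedDomain.isCompact (hΩ : IsClosedDomain Ω) : IsCompact Ω := by
  obtain ⟨U, -, -, hb, rfl⟩ := hΩ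
  exact hb.isCompact_closure

theorem lebesgueOn_univ (hΩ : IsClosedDomain Ω) : lebesgueOn Ω Set.univ = volume Ω := by
  rw [lebesgueOn, (MeasurableEmbedding.subtype_coe hΩ.isCompact.measurableSet).comap_apply]
  simp

theorem isFiniteMeasure_lebesgueOn (hΩ : IsClosedDomain Ω) : IsFiniteMeasure (lebesgueOn Ω) :=
  ⟨by rw [lebesgueOn_univ hΩ]; exact hΩ.isCompact.measure_lt_top⟩

theorem lebesgueOn_ne_zero (hΩ : IsClosedDomain Ω) : lebesgueOn Ω ≠ 0 := by
  rw [← Measure.measure_univ_ne_zero, lebesgueOn_univ hΩ]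
  obtain ⟨U, ho, hc, -, rfl⟩ := hΩ
  exact ((ho.measure_pos volume hc.nonempty).trans_le (measure_mono subset_closure)).ne'

theorem entropy_of_ac [IsFiniteMeasure (lebesgueOn Ω)] {ρ : ProbabilityMeasure Ω}
    (h : (ρ : Measure Ω) ≪ lebesgueOn Ω) :
    entropy ρ = (shiftedEntropy (lebesgueOn Ω) ρ : EReal) +
      ((-((lebesgueOn Ω).real Set.univ) : ℝ) : EReal) := by
  rw [entropy, if_pos h]
  have m := measurable_realDensity (μ := lebesgueOn Ω) ρ
  exact extendedIntegral_eq_sub (h := fun x => realDensity (lebesgueOn Ω) ρ x *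
    Real.log (realDensity (lebesgueOn Ω) ρ x)) (by fun_prop)
    fun x => neg_one_le_mul_log (realDensity_nonneg ρ x)

/-- The free energy plus a nonnegative term is, up to an additive constant, a penalized entropy. -/
theorem freeEnergy_add_eq [IsFiniteMeasure (lebesgueOn Ω)] {V : EuclideanSpace ℝ (Fin d) → ℝ}
    (mV : Measurable fun x : Ω => V x) {M : ℝ} (hM : ∀ x : Ω, |V x| ≤ M)
    (W : ProbabilityMeasure Ω → ℝ≥0∞) (ρ : ProbabilityMeasure Ω) :
    freeEnergy V ρ + (W ρ : EReal) =
      (penalizedEntropy (lebesgueOn Ω)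
        (fun ρ => ∫⁻ x, ENNReal.ofReal (V x + M) ∂(ρ : Measure Ω) + W ρ) ρ : EReal) +
      ((-((lebesgueOn Ω).real Set.univ) + -M : ℝ) : EReal) := by
  rw [freeEnergy]
  by_cases h : (ρ : Measure Ω) ≪ lebesgueOn Ω
  · rw [entropy_of_ac h, coe_integral_eq_sub ρ mV hM, penalizedEntropy_of_ac h,
      EReal.coe_ennreal_add, EReal.coe_ennreal_add, EReal.coe_add]
    abel
  · rw [entropy, if_neg h, penalizedEntropy, if_neg h, EReal.top_add_coe, EReal.coe_ennreal_top,
      EReal.top_add_coe, EReal.top_add_of_ne_bot (EReal.coe_ennreal_ne_bot _)]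

theorem coe_add_coe_le_iff {a b : ℝ≥0∞} {c : ℝ} :
    (a : EReal) + (c : EReal) ≤ (b : EReal) + (c : EReal) ↔ a ≤ b := by
  refine ⟨fun h => ?_, fun h => add_le_add_left (EReal.coe_ennreal_le_coe_ennreal_iff.2 h) _⟩
  have := add_le_add_left h ((-c : ℝ) : EReal)
  rwa [add_assoc, add_assoc, ← EReal.coe_add, add_neg_cancel, EReal.coe_zero, add_zero, add_zero,
    EReal.coe_ennreal_le_coe_ennreal_iff] at this

/-- The shifted potential is affine in `ρ` and lies between `0` and `2M`, so it adds no convexity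
defect and only `2M` to the Lipschitz constant of `W`. -/
theorem existsUnique_isMinimizer_freeEnergy_add (hΩ : IsClosedDomain Ω)
    {V : EuclideanSpace ℝ (Fin d) → ℝ} (mV : Measurable fun x : Ω => V x) {M : ℝ}
    (hM : ∀ x : Ω, |V x| ≤ M) {W : ProbabilityMeasure Ω → ℝ≥0∞} (hfin : ∀ ρ, W ρ ≠ ⊤)
    (hconv : ∀ ρ σ, 2 * W (probabilityMidpoint ρ σ) ≤ W ρ + W σ) {C : ℝ≥0∞} (hC : C ≠ ⊤)
    (hlip : ∀ ρ σ : ProbabilityMeasure Ω, (ρ : Measure Ω) ≪ lebesgueOn Ω →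
      (σ : Measure Ω) ≪ lebesgueOn Ω → W ρ ≤ W σ + C * ∫⁻ x,
        ‖realDensity (lebesgueOn Ω) ρ x - realDensity (lebesgueOn Ω) σ x‖ₑ ∂lebesgueOn Ω) :
    ∃! ρ : ProbabilityMeasure Ω, IsMinimizer (fun ρ => freeEnergy V ρ + (W ρ : EReal)) ρ := by
  have := isFiniteMeasure_lebesgueOn hΩ
  have mg : Measurable fun x : Ω => ENNReal.ofReal (V x + M) :=
    (mV.add_const M).ennreal_ofReal
  have hg : ∀ x : Ω, ENNReal.ofReal (V x + M) ≤ ENNReal.ofReal (M + M) := fun x =>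
    ENNReal.ofReal_le_ofReal (by linarith [le_of_abs_le (hM x)])
  simp only [IsMinimizer, freeEnergy_add_eq mV hM, coe_add_coe_le_iff]
  refine existsUnique_minimizer_penalizedEntropy (C := ENNReal.ofReal (M + M) + C)
    (lebesgueOn_ne_zero hΩ) (fun ρ => ENNReal.add_ne_top.2 ⟨?_, hfin ρ⟩) (fun ρ σ => ?_)
    (by finiteness) fun ρ σ hρ hσ => ?_
  · refine ne_top_of_le_ne_top (ENNReal.ofReal_ne_top (r := M + M)) ((lintegral_mono hg).trans ?_)
    simp
  · rw [mul_add, two_mul_lintegral_probabilityMidpoint, add_add_add_comm (lintegral _ _)]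
    exact add_le_add_right (hconv ρ σ) _
  · refine (add_le_add (lintegral_le_add mg hg hρ hσ) (hlip ρ σ hρ hσ)).trans_eq ?_
    ring

theorem existsUnique_isMinimizer_freeEnergy (hΩ : IsClosedDomain Ω)
    {V : EuclideanSpace ℝ (Fin d) → ℝ} (mV : Measurable fun x : Ω => V x) {M : ℝ}
    (hM : ∀ x : Ω, |V x| ≤ M) :
    ∃! ρ : ProbabilityMeasure Ω, IsMinimizer (freeEnergy V) ρ := by
  simpa [IsMinimizer] using existsUnique_isMinimizer_freeEnergy_add hΩ mV hM (W := fun _ => 0)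
    (by simp) (by simp) ENNReal.zero_ne_top (by simp)

theorem existsUnique_isMinimizer_jkoFunctional (hΩ : IsClosedDomain Ω)
    {V : EuclideanSpace ℝ (Fin d) → ℝ} (mV : Measurable fun x : Ω => V x) {M : ℝ}
    (hM : ∀ x : Ω, |V x| ≤ M) {τ : ℝ} (hτ : 0 < τ) (σ : ProbabilityMeasure Ω) :
    ∃! ρ : ProbabilityMeasure Ω, IsMinimizer (jkoFunctional V τ σ) ρ := by
  have := isFiniteMeasure_lebesgueOn hΩ
  set t : ℝ≥0∞ := (ENNReal.ofReal (2 * τ))⁻¹ with ht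
  have htt : t ≠ ⊤ := by simpa [ht] using hτ
  set c : Ω × Ω → ℝ≥0∞ := fun z => edist z.1 z.2 ^ 2 with hc
  -- The squared diameter of `Ω` bounds the cost; it is finite because `Ω` is compact.
  set D : ℝ≥0∞ := Metric.ediam Ω ^ 2 with hD
  have hDt : D ≠ ⊤ := ENNReal.pow_ne_top hΩ.isCompact.isBounded.ediam_ne_top
  have hcD : ∀ z, c z ≤ D := fun z =>
    pow_le_pow_left' (Metric.edist_le_ediam_of_mem z.1.2 z.2.2) 2
  have hW : jkoFunctional V τ σ =
      fun ρ => freeEnergy V ρ + ((t * transportCost c ρ σ : ℝ≥0∞) : EReal) := by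
    funext ρ
    rw [jkoFunctional, wasserstein2_sq, div_eq_mul_inv, mul_comm]
  rw [hW]
  refine existsUnique_isMinimizer_freeEnergy_add (C := t * D) hΩ mV hM (fun ρ => ?_)
    (fun ρ ρ' => ?_) (ENNReal.mul_ne_top htt hDt) fun ρ ρ' hρ hρ' => ?_
  · exact ENNReal.mul_ne_top htt (ne_top_of_le_ne_top hDt (transportCost_le hcD ρ σ))
  · rw [mul_left_comm, ← mul_add]
    exact mul_le_mul_right (transportCost_midpoint_le c σ ρ ρ') t
  · rw [mul_assoc, ← mul_add]
    exact mul_le_mul_right (transportCost_le_add hcD σ hρ hρ') t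

theorem exists_le_freeEnergy (hΩ : IsClosedDomain Ω)
    {V : EuclideanSpace ℝ (Fin d) → ℝ} (mV : Measurable fun x : Ω => V x) {M : ℝ}
    (hM : ∀ x : Ω, |V x| ≤ M) :
    ∃ C : ℝ, ∀ ρ : ProbabilityMeasure Ω, (C : EReal) ≤ freeEnergy V ρ := by
  have := isFiniteMeasure_lebesgueOn hΩ
  refine ⟨-((lebesgueOn Ω).real Set.univ) + -M, fun ρ => ?_⟩
  have h := freeEnergy_add_eq mV hM (fun _ => 0) ρ
  simp only [EReal.coe_ennreal_zero, add_zero] at h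
  rw [h]
  exact le_add_of_nonneg_left (EReal.coe_ennreal_nonneg _)

end Domain
end

theorem mainTheorem8 {d : ℕ} (Ω : Set (EuclideanSpace ℝ (Fin d))) (hΩ : IsClosedDomain Ω)
    (V : EuclideanSpace ℝ (Fin d) → ℝ) (hV : ContDiffOn ℝ 1 V Ω) :
    (∃! ρ : ProbabilityMeasure Ω, IsMinimizer (freeEnergy V) ρ) ∧
    (∃ C : ℝ, ∀ ρ : ProbabilityMeasure Ω, (C : EReal) ≤ freeEnergy V ρ) ∧
    (∀ τ : ℝ, 0 < τ → ∀ ρ₀ : ProbabilityMeasure Ω, freeEnergy V ρ₀ < ⊤ →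
      ∃ ρ : ℕ → ProbabilityMeasure Ω, ρ 0 = ρ₀ ∧
        ∀ k : ℕ, IsMinimizer (jkoFunctional V τ (ρ k)) (ρ (k + 1)) ∧
          ∀ σ : ProbabilityMeasure Ω,
            IsMinimizer (jkoFunctional V τ (ρ k)) σ → σ = ρ (k + 1)) := by
  have mV : Measurable fun x : Ω => V x :=
    (continuousOn_iff_continuous_domRestrict.1 hV.continuousOn).measurable
  obtain ⟨M, hM⟩ := hΩ.isCompact.exists_bound_of_continuousOn hV.continuousOn
  have hM' : ∀ x : Ω, |V x| ≤ M := fun x => hM x x.2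
  refine ⟨existsUnique_isMinimizer_freeEnergy hΩ mV hM', exists_le_freeEnergy hΩ mV hM',
    fun τ hτ ρ₀ _ => ?_⟩
  -- The scheme is the orbit of `ρ₀` under the map sending `σ` to the unique minimizer of its
  -- one-step functional.
  choose step hstep huniq using
    fun σ : ProbabilityMeasure Ω => existsUnique_isMinimizer_jkoFunctional hΩ mV hM' hτ σ
  exact ⟨fun k => step^[k] ρ₀, rfl, fun k => by
    simp only [Function.iterate_succ_apply']
    exact ⟨hstep _, huniq _⟩⟩
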